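/- Let $d\in\mathbb N$, let $B_d$ be the open unit ball of $\mathbb C^d$, and let $\mathcal H^2_d$ be the Drury–Arveson space, i.e. the reproducing kernel Hilbert space (RKHS) on $B_d$ with kernel $k(x,y)=\frac{1}{1-\langle x,y\rangle}$ and kernel functions $k_y=k(\cdot,y)$. A variety in $B_d$ is the common zero set in $B_d$ of a non-empty subset of $\mathcal H^2_d$. For a variety $V$ let $H_V=\overline{\operatorname{span}}\{k_x:x\in V\}\subseteq\mathcal H^2_d$, regarded by restriction as an RKHS of functions on $V$, and let $\mathcal M_V$ be the algebra of all $f:V\to\mathbb C$ with $fH_V\subseteq H_V$; for such $f$ let $M_f$ be the bounded operator $g\mapsto fg$ on $H_V$. Norm $M_n(\mathcal M_V)$ by $\|[f_{ij}]\|=\|[M_{f_{ij}}]\|$ (operator norm on the Hilbert space direct sum of $n$ copies of $H_V$), and for an algebra homomorphism $\varphi:\mathcal M_V\to\mathcal M_W$ put $\|\varphi\|_{cb}=\sup_n\|\varphi^{(n)}\|$, where $\varphi^{(n)}[f_{ij}]=[\varphi(f_{ij})]$. A multiplier algebra isomorphism is an algebra isomorphism $\varphi:\mathcal M_V\to\mathcal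 M_W$ with $\|\varphi\|_{cb}<\infty$ and $\|\varphi^{-1}\|_{cb}<\infty$ that is of the form $\varphi(f)=f\circ G$ for a bijection $G:W\to V$. A map $G=(g_1,\dots,g_d):W\to\mathbb C^d$ is a vector valued multiplier on $W$ if all $g_i\in\mathcal M_W$, and then $\|G\|_{Mult(W)}$ is the norm of the row operator $(M_{g_1},\dots,M_{g_d}):\bigoplus_{i=1}^dH_W\to H_W$. Let $V$ and $W$ be varieties in $B_d$ and let $T_F:H_V\to H_W$ be an RKHS isomorphism, i.e. a bounded invertible linear map such that $$T_F(k_x)=\lambda(x)k_{F(x)},\qquad x\in V,$$ for a bijection $F:V\to W$ and a nowhere vanishing function $\lambda:V\to\mathbb C$. Then $\varphi(f)=f\circ F^{-1}$ $(f\in\mathcal M_V)$ defines a multiplier algebra isomorphism $\varphi:\mathcal M_V\to\mathcal M_W$. Moreover, if $V$ contains at least two points, then $F^{-1}$ is a vector valued multiplier on $W$ and $$\frac1{\|\varphi^{-1}\|_{cb}}\le\|F^{-1}\|_{Mult(W)}\le\|\varphi\|_{cb}\le\|T_F\|\,\|T_F^{-1}\|.$$ -/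

import Mathlib

open scoped ENNReal ComplexOrder

noncomputable section

/-! ### Multipliers of a reproducing kernel Hilbert space -/

namespace RKHSMult

variable {X Y : Type*}
variable (H : Type*) [NormedAddCommGroup H] [InnerProductSpace ℂ H] [CompleteSpace H] [RKHS ℂ H X ℂ]
variable (K : Type*) [NormedAddCommGroup K] [InnerProductSpace ℂ K] [CompleteSpace K] [RKHS ℂ K Y ℂ]

/-- The multiplier algebra of a reproducing kernel Hilbert space `H` of complex functions on `X`:
all functions `f : X → ℂ` such that `f g ∈ H` for every `g ∈ H`. -/
def Mult : Subalgebra ℂ (X → ℂ) where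
  carrier := {f | ∀ g : H, ∃ h : H, ∀ x, h x = f x * g x}
  mul_mem' {a b} ha hb g := by
    obtain ⟨h, hh⟩ := hb g
    obtain ⟨h', hh'⟩ := ha h
    exact ⟨h', fun x => by simp [hh', hh, mul_assoc]⟩
  add_mem' {a b} ha hb g := by
    obtain ⟨h, hh⟩ := ha g
    obtain ⟨h', hh'⟩ := hb g
    exact ⟨h + h', fun x => by simp [hh', hh, add_mul]⟩
  algebraMap_mem' c g := ⟨c • g, fun x => by simp⟩

variable {H K}

/-- The multiplication operator `M_f` as a linear map. -/
def mulLin (f : Mult H) : H →ₗ[ℂ] H where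
  toFun g := Classical.choose (f.2 g)
  map_add' g g' := by
    refine RKHS.ext fun x => ?_
    have h1 := Classical.choose_spec (f.2 (g + g')) x
    have h2 := Classical.choose_spec (f.2 g) x
    have h3 := Classical.choose_spec (f.2 g') x
    simp only [RKHS.coe_add, Pi.add_apply] at h1 ⊢
    rw [h1, h2, h3, mul_add]
  map_smul' c g := by
    refine RKHS.ext fun x => ?_
    have h1 := Classical.choose_spec (f.2 (c • g)) x
    have h2 := Classical.choose_spec (f.2 g) x
    simp only [RKHS.coe_smul, Pi.smul_apply, RingHom.id_apply, smul_eq_mul] at h1 ⊢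
    rw [h1, h2]
    ring

theorem mulLin_apply (f : Mult H) (g : H) (x : X) : mulLin f g x = (f : X → ℂ) x * g x :=
  Classical.choose_spec (f.2 g) x

theorem mulLin_continuous (f : Mult H) : Continuous (mulLin f) := by
  refine LinearMap.continuous_of_seq_closed_graph (mulLin f) fun u a b hu hv => ?_
  refine RKHS.ext fun x => ?_
  have h1 : Filter.Tendsto (fun n => (mulLin f (u n)) x) Filter.atTop (nhds (b x)) :=
    ((RKHS.continuous_eval (H := H) x).tendsto b).comp hv
  have h2 : Filter.Tendsto (fun n => (f : X → ℂ) x * u n x) Filter.atTop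
      (nhds ((f : X → ℂ) x * a x)) :=
    (((RKHS.continuous_eval (H := H) x).tendsto a).comp hu).const_mul _
  simp only [mulLin_apply] at h1 ⊢
  exact tendsto_nhds_unique h1 h2

/-- The bounded multiplication operator `M_f : H → H`, `g ↦ f g`. -/
def mulOp (f : Mult H) : H →L[ℂ] H := ⟨mulLin f, mulLin_continuous f⟩

theorem mulOp_apply (f : Mult H) (g : H) (x : X) : mulOp f g x = (f : X → ℂ) x * g x :=
  mulLin_apply f g x

/-- The operator `[M_{f i j}]` on the Hilbert space direct sum of `n` copies of `H`. -/
def matOp {n : ℕ} (A : Matrix (Fin n) (Fin n) (Mult H)) :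
    PiLp 2 (fun _ : Fin n => H) →L[ℂ] PiLp 2 (fun _ : Fin n => H) :=
  (PiLp.continuousLinearEquiv 2 ℂ (fun _ : Fin n => H)).symm.toContinuousLinearMap ∘L
    ContinuousLinearMap.pi fun i =>
      ∑ j, mulOp (A i j) ∘L PiLp.proj (𝕜 := ℂ) 2 (fun _ : Fin n => H) j

theorem matOp_apply {n : ℕ} (A : Matrix (Fin n) (Fin n) (Mult H))
    (g : PiLp 2 (fun _ : Fin n => H)) (i : Fin n) :
    matOp A g i = ∑ j, mulOp (A i j) (g j) := by
  simp [matOp]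

/-- The norm, in `[0, ∞]`, of the `n`-th amplification `φ⁽ⁿ⁾ [f i j] = [φ (f i j)]` of `φ`, where
`Mₙ(Mult H)` and `Mₙ(Mult K)` carry the operator norms of `[M_{f i j}]`. -/
def amplNorm (φ : Mult H →ₐ[ℂ] Mult K) (n : ℕ) : ℝ≥0∞ :=
  ⨆ (A : Matrix (Fin n) (Fin n) (Mult H)) (_ : ‖matOp A‖ ≤ 1),
    ENNReal.ofReal ‖matOp (A.map φ)‖

/-- The completely bounded norm of `φ`, in `[0, ∞]`. -/
def cbNorm (φ : Mult H →ₐ[ℂ] Mult K) : ℝ≥0∞ := ⨆ n : ℕ, amplNorm φ n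

/-- `φ` is a multiplier algebra isomorphism: an algebra isomorphism which is completely bounded
with completely bounded inverse, and which is given by composition with a bijection. -/
structure IsMultiplierAlgebraIso (φ : Mult H ≃ₐ[ℂ] Mult K) : Prop where
  cbNorm_lt_top : cbNorm φ.toAlgHom < ∞
  cbNorm_symm_lt_top : cbNorm φ.symm.toAlgHom < ∞
  exists_bijection : ∃ G : Y ≃ X, ∀ (f : Mult H) (y : Y), (φ f : Y → ℂ) y = (f : X → ℂ) (G y)

variable (H) in
/-- `F = (f₁, …, f_d)` is a vector valued multiplier of `H`: each coordinate is a multiplier. -/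
def IsVectorMult {d : ℕ} (F : X → EuclideanSpace ℂ (Fin d)) : Prop :=
  ∀ i, (fun x => F x i) ∈ Mult H

/-- The row operator `M_F (g₁, …, g_d) = ∑ i, f i * g i` from the Hilbert space direct sum of `d`
copies of `H` to `H`. -/
def rowOp {d : ℕ} {F : X → EuclideanSpace ℂ (Fin d)} (hF : IsVectorMult H F) :
    PiLp 2 (fun _ : Fin d => H) →L[ℂ] H :=
  ∑ i, mulOp ⟨fun x => F x i, hF i⟩ ∘L PiLp.proj (𝕜 := ℂ) 2 (fun _ : Fin d => H) i

theorem rowOp_apply {d : ℕ} {F : X → EuclideanSpace ℂ (Fin d)} (hF : IsVectorMult H F)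
    (g : PiLp 2 (fun _ : Fin d => H)) (x : X) : rowOp hF g x = ∑ i, F x i * g i x := by
  rw [rowOp, ← RKHS.coeCLM_apply (𝕜 := ℂ)]
  simp [mulOp_apply]

/-- The multiplier norm of a vector valued multiplier. -/
def vectorMultNorm {d : ℕ} {F : X → EuclideanSpace ℂ (Fin d)} (hF : IsVectorMult H F) : ℝ :=
  ‖rowOp hF‖

end RKHSMult

/-! ### The Drury-Arveson space and its restrictions to varieties -/

namespace DruryArveson

/-- The open unit ball of `ℂ^d`. -/
abbrev Ball (d : ℕ) : Type := Metric.ball (0 : EuclideanSpace ℂ (Fin d)) 1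

/-- The scalar kernel `k(x, y) = 1 / (1 - ⟨x, y⟩)`, where `⟨x, y⟩ = ∑ i, x i * conj (y i)` is
linear in `x`, i.e. `⟨x, y⟩ = inner ℂ y x`. -/
def scalarKernel (d : ℕ) : Matrix (Ball d) (Ball d) ℂ :=
  .of fun x y => 1 / (1 - inner ℂ (y : EuclideanSpace ℂ (Fin d)) (x : EuclideanSpace ℂ (Fin d)))

/-- The same kernel, a number being identified with a multiplication operator on `ℂ`. -/
def kernel (d : ℕ) : Matrix (Ball d) (Ball d) (ℂ →L[ℂ] ℂ) :=
  .of fun x y => scalarKernel d x y • ContinuousLinearMap.id ℂ ℂ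

theorem posSemidef_gram (d : ℕ) :
    (Matrix.of fun x y : Ball d => inner ℂ (x : EuclideanSpace ℂ (Fin d))
      (y : EuclideanSpace ℂ (Fin d))).PosSemidef := by
  refine ⟨?_, fun v => ?_⟩
  · ext x y
    simp only [Matrix.conjTranspose_apply, Matrix.of_apply]
    exact inner_conj_symm _ _
  · have h : (v.sum fun x w => v.sum fun y w' => star w * (Matrix.of fun x y : Ball d =>
        inner ℂ (x : EuclideanSpace ℂ (Fin d)) (y : EuclideanSpace ℂ (Fin d))) x y * w') =
        inner ℂ (∑ x ∈ v.support, v x • (x : EuclideanSpace ℂ (Fin d)))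
          (∑ x ∈ v.support, v x • (x : EuclideanSpace ℂ (Fin d))) := by
      simp only [Finsupp.sum, sum_inner]
      refine Finset.sum_congr rfl fun x _ => ?_
      simp only [inner_sum]
      refine Finset.sum_congr rfl fun y _ => ?_
      rw [inner_smul_left, inner_smul_right, Matrix.of_apply, starRingEnd_apply]
      ring
    rw [h, inner_self_eq_norm_sq_to_K]
    positivity

theorem posSemidef_pow (d n : ℕ) :
    (Matrix.of fun x y : Ball d => (inner ℂ (x : EuclideanSpace ℂ (Fin d))
      (y : EuclideanSpace ℂ (Fin d))) ^ n).PosSemidef := by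
  induction n with
  | zero =>
    refine ⟨by ext x y; simp, fun v => ?_⟩
    have h : (v.sum fun x w => v.sum fun y w' => star w * (Matrix.of fun x y : Ball d =>
        (inner ℂ (x : EuclideanSpace ℂ (Fin d)) (y : EuclideanSpace ℂ (Fin d))) ^ 0) x y * w') =
        star (∑ x ∈ v.support, v x) * ∑ x ∈ v.support, v x := by
      simp [Finsupp.sum, Finset.sum_mul_sum]
    rw [h]
    exact star_mul_self_nonneg _
  | succ n ih =>
    have h : (Matrix.of fun x y : Ball d => (inner ℂ (x : EuclideanSpace ℂ (Fin d))
        (y : EuclideanSpace ℂ (Fin d))) ^ (n + 1)) = Matrix.hadamard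
          (Matrix.of fun x y : Ball d => (inner ℂ (x : EuclideanSpace ℂ (Fin d))
            (y : EuclideanSpace ℂ (Fin d))) ^ n)
          (Matrix.of fun x y : Ball d => inner ℂ (x : EuclideanSpace ℂ (Fin d))
            (y : EuclideanSpace ℂ (Fin d))) := by
      ext x y
      simp [pow_succ]
    rw [h]
    exact ih.hadamard (posSemidef_gram d)

theorem norm_inner_lt_one {d : ℕ} (x y : Ball d) :
    ‖inner ℂ (x : EuclideanSpace ℂ (Fin d)) (y : EuclideanSpace ℂ (Fin d))‖ < 1 := by
  have hx : ‖(x : EuclideanSpace ℂ (Fin d))‖ < 1 := mem_ball_zero_iff.1 x.2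
  have hy : ‖(y : EuclideanSpace ℂ (Fin d))‖ < 1 := mem_ball_zero_iff.1 y.2
  have := norm_inner_le_norm (𝕜 := ℂ) (x : EuclideanSpace ℂ (Fin d)) y
  nlinarith [norm_nonneg (x : EuclideanSpace ℂ (Fin d)),
    norm_nonneg (y : EuclideanSpace ℂ (Fin d))]

theorem inner_kernel {d : ℕ} (x y : Ball d) (w w' : ℂ) :
    inner ℂ (kernel d x y w) w' = star w *
      (1 - inner ℂ (x : EuclideanSpace ℂ (Fin d)) (y : EuclideanSpace ℂ (Fin d)))⁻¹ * w' := by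
  have h1 : kernel d x y w =
      (1 - inner ℂ (y : EuclideanSpace ℂ (Fin d)) (x : EuclideanSpace ℂ (Fin d)))⁻¹ * w := by
    simp [kernel, scalarKernel]
  rw [h1, RCLike.inner_apply, map_mul, map_inv₀, map_sub, map_one, inner_conj_symm,
    starRingEnd_apply]
  ring

theorem kernel_posSemidef (d : ℕ) : (kernel d).PosSemidef := by
  have hiff := (RKHS.posSemidef_tfae (K := kernel d)).out 0 2
  refine hiff.2 ⟨?_, fun v => ?_⟩
  · ext x y
    simp [kernel, scalarKernel, ContinuousLinearMap.star_eq_adjoint, ContinuousLinearMap.adjoint_id]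
  · have hsum : HasSum (fun n : ℕ => v.sum fun x w => v.sum fun x' w' =>
        star w * (inner ℂ (x' : EuclideanSpace ℂ (Fin d)) (x : EuclideanSpace ℂ (Fin d))) ^ n * w')
        (v.sum fun x w => v.sum fun x' w' => inner ℂ (kernel d x' x w) w') := by
      refine hasSum_sum fun x _ => hasSum_sum fun x' _ => ?_
      have h := ((hasSum_geometric_of_norm_lt_one (norm_inner_lt_one x' x)).mul_left
        (star (v x))).mul_right (v x')
      rw [← inner_kernel] at h
      exact h
    have hnn : (0 : ℂ) ≤ v.sum fun x w => v.sum fun x' w' => inner ℂ (kernel d x' x w) w' :=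
      hsum.nonneg fun n => (posSemidef_pow d n).transpose.2 v
    exact (Complex.le_def.1 hnn).1

instance (d : ℕ) : Fact (kernel d).PosSemidef := ⟨kernel_posSemidef d⟩

/-- The Drury-Arveson space `H²_d`: the reproducing kernel Hilbert space on the ball with kernel
`k(x, y) = 1 / (1 - ⟨x, y⟩)`. -/
def Space (d : ℕ) : Type := RKHS.OfKernel (kernel d)

instance (d : ℕ) : NormedAddCommGroup (Space d) :=
  inferInstanceAs (NormedAddCommGroup (RKHS.OfKernel (kernel d)))

instance (d : ℕ) : InnerProductSpace ℂ (Space d) :=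
  inferInstanceAs (InnerProductSpace ℂ (RKHS.OfKernel (kernel d)))

instance (d : ℕ) : CompleteSpace (Space d) :=
  inferInstanceAs (CompleteSpace (RKHS.OfKernel (kernel d)))

instance (d : ℕ) : RKHS ℂ (Space d) (Ball d) ℂ :=
  RKHS.OfKernel.instRKHS (K := kernel d)

/-- The kernel function `k_y` as an element of the Drury-Arveson space. -/
def ker {d : ℕ} (y : Ball d) : Space d := RKHS.kerFun (Space d) y 1

theorem ker_apply {d : ℕ} (x y : Ball d) :
    ker y x = 1 / (1 - inner ℂ (y : EuclideanSpace ℂ (Fin d)) (x : EuclideanSpace ℂ (Fin d))) := by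
  rw [ker, RKHS.kerFun_apply]
  have : RKHS.kernel (Space d) = kernel d := RKHS.OfKernel.kernel_ofKernel (K := kernel d)
  rw [this]
  simp [kernel, scalarKernel]

theorem inner_ker {d : ℕ} (x : Ball d) (f : Space d) : inner ℂ (ker x) f = f x := by
  simp [ker]

/-- Varieties in the ball: common zero sets of non-empty families in the Drury-Arveson space. -/
def IsVariety {d : ℕ} (V : Set (Ball d)) : Prop :=
  ∃ S : Set (Space d), S.Nonempty ∧ V = {x | ∀ f ∈ S, f x = 0}

/-- `H_V`, the closed span of the kernel functions at the points of `V`. -/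
def HV {d : ℕ} (V : Set (Ball d)) : Submodule ℂ (Space d) :=
  (Submodule.span ℂ (ker '' V)).topologicalClosure

instance {d : ℕ} (V : Set (Ball d)) : CompleteSpace (HV V) :=
  (Submodule.isClosed_topologicalClosure _).completeSpace_coe

theorem eq_zero_of_forall_apply_eq_zero {d : ℕ} {V : Set (Ball d)} (f : HV V)
    (hf : ∀ x ∈ V, (f : Space d) x = 0) : f = 0 := by
  have h : (f : Space d) ∈ (HV V)ᗮ := by
    have hspan : (HV V)ᗮ = (Submodule.span ℂ (ker '' V))ᗮ := Submodule.orthogonal_closure _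
    rw [hspan, Submodule.mem_orthogonal]
    intro u hu
    induction hu using Submodule.span_induction with
    | mem u hu =>
      obtain ⟨x, hx, rfl⟩ := hu
      rw [inner_ker, hf x hx]
    | zero => simp
    | add u v _ _ hu hv => rw [inner_add_left, hu, hv, add_zero]
    | smul c u _ hu => rw [inner_smul_left, hu, mul_zero]
  have h0 := Submodule.inner_right_of_mem_orthogonal f.2 h
  exact Subtype.ext (inner_self_eq_zero.1 h0)

/-- `H_V` is a reproducing kernel Hilbert space on `V`, through restriction of functions to `V`. -/
instance {d : ℕ} (V : Set (Ball d)) : RKHS ℂ (HV V) V ℂ where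
  coeCLM := (ContinuousLinearMap.pi fun x : V =>
    ContinuousLinearMap.proj (R := ℂ) (φ := fun _ : Ball d => ℂ) (x : Ball d)) ∘L
      RKHS.coeCLM (H := Space d) ℂ ∘L (HV V).subtypeL
  coeCLM_injective := by
    refine (injective_iff_map_eq_zero _).2 fun f hf => ?_
    refine eq_zero_of_forall_apply_eq_zero f fun x hx => ?_
    exact congrFun hf ⟨x, hx⟩

theorem HV_apply {d : ℕ} {V : Set (Ball d)} (f : HV V) (x : V) : f x = (f : Space d) x := rfl

/-- The kernel function `k_x`, `x ∈ V`, as an element of `H_V`. -/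
def kerV {d : ℕ} {V : Set (Ball d)} (x : V) : HV V :=
  ⟨ker x, Submodule.le_topologicalClosure _ (Submodule.subset_span ⟨x, x.2, rfl⟩)⟩

/-- The multiplier algebra `M_V` of `H_V`. -/
abbrev MV {d : ℕ} (V : Set (Ball d)) : Subalgebra ℂ (V → ℂ) := RKHSMult.Mult (HV V)

/-- `T : H_V → H_W` is a reproducing kernel Hilbert space isomorphism, implemented by the bijection
`F : V → W` and the nowhere vanishing function `lam` on `V`. -/
structure IsRKHSIso {d : ℕ} {V W : Set (Ball d)} (T : HV V ≃L[ℂ] HV W) (F : V ≃ W)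
    (lam : V → ℂ) : Prop where
  ne_zero : ∀ x, lam x ≠ 0
  map_kerV : ∀ x, T (kerV x) = lam x • kerV (F x)

end DruryArveson

end

/-!
Since `T k_x = lam x • k_{F x}` and `M_f* k_x = conj (f x) • k_x`, the operator `(T⁻¹)* M_f T*` on
`H_W` is multiplication by `f ∘ F⁻¹` (`IsRKHSIso.adjoint_mulOp_adjoint_apply`). So `f ↦ f ∘ F⁻¹`
maps multipliers to multipliers, and as it is implemented by the fixed operators `(T⁻¹)*` and `T*`
its completely bounded norm is at most `‖T‖ ‖T⁻¹‖` (`cbNorm_le_of_mulOp_eq`). The inverse of `T` is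
again an isomorphism of the same kind, which gives the same bound for `φ⁻¹`.

For the two estimates of `‖F⁻¹‖` the point is that the row of coordinate functions on `V` has
multiplier norm exactly one once `V` has two points. Its adjoint sends `k_x` to
`(conj xᵢ k_x)ᵢ`, and because `⟨x, y⟩ k(x, y) = k(x, y) - 1` it satisfies
`‖∑ c_x (conj xᵢ k_x)ᵢ‖² = ‖∑ c_x k_x‖² - |∑ c_x|²` (`norm_sq_linearCombination_coordKer`). Thus it is
a contraction, and it preserves the norm of `k_x - k_y`, which is nonzero for `x ≠ y`. Applying an
amplification of `φ` to the coordinate row, padded with zero rows, gives `F⁻¹`, and `φ⁻¹` takes it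
back; hence `‖F⁻¹‖ ≤ ‖φ‖_cb` and `1 ≤ ‖φ⁻¹‖_cb ‖F⁻¹‖`.
-/

noncomputable section

open RKHSMult

namespace RKHSMult

variable {X Y : Type*}
variable {H : Type*} [NormedAddCommGroup H] [InnerProductSpace ℂ H] [CompleteSpace H] [RKHS ℂ H X ℂ]
variable {K : Type*} [NormedAddCommGroup K] [InnerProductSpace ℂ K] [CompleteSpace K] [RKHS ℂ K Y ℂ]

/-! ### Amplifications and completely bounded norms -/

theorem norm_toLp_comp_le {H K : Type*} [NormedAddCommGroup H] [InnerProductSpace ℂ H]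
    [NormedAddCommGroup K] [InnerProductSpace ℂ K] {n : ℕ} (L : H →L[ℂ] K) (g : Fin n → H) :
    ‖(WithLp.toLp 2 fun i => L (g i) : PiLp 2 fun _ : Fin n => K)‖ ≤
      ‖L‖ * ‖(WithLp.toLp 2 g : PiLp 2 fun _ : Fin n => H)‖ := by
  refine abs_le_of_sq_le_sq' ?_ (by positivity) |>.2
  rw [mul_pow, PiLp.norm_sq_eq_of_L2, PiLp.norm_sq_eq_of_L2, Finset.mul_sum]
  refine Finset.sum_le_sum fun i _ => ?_
  rw [← mul_pow]
  exact pow_le_pow_left₀ (norm_nonneg _) (L.le_opNorm _) 2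

theorem norm_matOp_le_of_mulOp_eq {n : ℕ} (L : H →L[ℂ] K) (R : K →L[ℂ] H)
    (A : Matrix (Fin n) (Fin n) (Mult H)) (B : Matrix (Fin n) (Fin n) (Mult K))
    (h : ∀ i j g, mulOp (B i j) g = L (mulOp (A i j) (R g))) :
    ‖matOp B‖ ≤ ‖L‖ * ‖R‖ * ‖matOp A‖ := by
  refine ContinuousLinearMap.opNorm_le_bound _ (by positivity) fun g => ?_
  set g' : PiLp 2 fun _ : Fin n => H := WithLp.toLp 2 fun i => R (g i) with hg'
  have hB : matOp B g = WithLp.toLp 2 fun i => L (matOp A g' i) := by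
    ext i : 1
    simp [matOp_apply, h, g', map_sum]
  calc ‖matOp B g‖ ≤ ‖L‖ * ‖matOp A g'‖ := hB ▸ norm_toLp_comp_le L _
    _ ≤ ‖L‖ * (‖matOp A‖ * (‖R‖ * ‖g‖)) := by
        gcongr
        exact ((matOp A).le_opNorm g').trans (by gcongr; exact norm_toLp_comp_le R _)
    _ = _ := by ring

/-- A homomorphism of multiplier algebras that is spatially implemented, `M_{φ f} = L M_f R`, is
completely bounded by `‖L‖ ‖R‖`, since its amplifications are implemented by the diagonal
operators with entries `L` and `R`. -/
theorem cbNorm_le_of_mulOp_eq (φ : Mult H →ₐ[ℂ] Mult K) (L : H →L[ℂ] K) (R : K →L[ℂ] H)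
    (h : ∀ f g, mulOp (φ f) g = L (mulOp f (R g))) :
    cbNorm φ ≤ ENNReal.ofReal (‖L‖ * ‖R‖) := by
  refine iSup_le fun n => iSup₂_le fun A hA => ENNReal.ofReal_le_ofReal ?_
  refine (norm_matOp_le_of_mulOp_eq L R A (A.map φ) fun i j g => h _ g).trans ?_
  exact mul_le_of_le_one_right (by positivity) hA

theorem mulOp_smul (c : ℂ) (f : Mult H) (g : H) : mulOp (c • f) g = c • mulOp f g :=
  RKHS.ext fun x => by simp [mulOp_apply, mul_assoc]

theorem matOp_smul {n : ℕ} (c : ℂ) (A : Matrix (Fin n) (Fin n) (Mult H)) :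
    matOp (c • A) = c • matOp A := by
  ext g i : 2
  simp [matOp_apply, mulOp_smul, Finset.smul_sum]

theorem ofReal_norm_matOp_map_le_cbNorm {n : ℕ} (φ : Mult H →ₐ[ℂ] Mult K)
    {A : Matrix (Fin n) (Fin n) (Mult H)} (hA : ‖matOp A‖ ≤ 1) :
    ENNReal.ofReal ‖matOp (A.map φ)‖ ≤ cbNorm φ :=
  (le_iSup₂_of_le A hA le_rfl).trans (le_iSup (amplNorm φ) n)

theorem norm_matOp_map_le {n : ℕ} {φ : Mult H →ₐ[ℂ] Mult K} (hφ : cbNorm φ ≠ ∞)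
    (A : Matrix (Fin n) (Fin n) (Mult H)) :
    ‖matOp (A.map φ)‖ ≤ (cbNorm φ).toReal * ‖matOp A‖ := by
  -- `‖matOp A‖` may be zero, so `A` is rescaled by any `r > ‖matOp A‖`.
  have key : ∀ r, ‖matOp A‖ < r → ‖matOp (A.map φ)‖ ≤ (cbNorm φ).toReal * r := by
    intro r hr
    have hr0 : 0 < r := (norm_nonneg _).trans_lt hr
    have hn : ‖((r : ℂ)⁻¹)‖ = r⁻¹ := by simp [abs_of_pos hr0]
    have h1 : ‖matOp ((r : ℂ)⁻¹ • A)‖ ≤ 1 := by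
      rw [matOp_smul, norm_smul, hn, inv_mul_le_iff₀ hr0, mul_one]
      exact hr.le
    have h2 := ofReal_norm_matOp_map_le_cbNorm φ h1
    have h3 : ((r : ℂ)⁻¹ • A).map φ = (r : ℂ)⁻¹ • A.map φ := by
      ext i j : 2
      simp
    rw [h3, matOp_smul, norm_smul, hn, ENNReal.ofReal_le_iff_le_toReal hφ,
      inv_mul_le_iff₀ hr0] at h2
    rwa [mul_comm]
  refine ge_of_tendsto (f := fun r => (cbNorm φ).toReal * r) (x := nhdsWithin ‖matOp A‖ (Set.Ioi _))
    ?_ (eventually_mem_nhdsWithin.mono key)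
  exact ((continuous_const.mul continuous_id).tendsto _).mono_left nhdsWithin_le_nhds

/-- A row of multipliers, padded with zero rows to a square matrix, keeps its norm. -/
theorem norm_matOp_updateRow {d : ℕ} {F : X → EuclideanSpace ℂ (Fin d)} (hF : IsVectorMult H F)
    (i₀ : Fin d) :
    ‖matOp (Matrix.updateRow (0 : Matrix (Fin d) (Fin d) (Mult H)) i₀
      fun i => ⟨fun x => F x i, hF i⟩)‖ = ‖rowOp hF‖ := by
  refine ContinuousLinearMap.opNorm_ext _ _ fun g => ?_
  have h0 : ∀ g : H, mulOp (0 : Mult H) g = 0 := fun g => RKHS.ext fun x => by simp [mulOp_apply]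
  rw [← PiLp.norm_single 2 (fun _ : Fin d => H) i₀ (rowOp hF g)]
  congr 1
  ext i : 1
  rcases eq_or_ne i i₀ with rfl | hi
  · simp [matOp_apply, rowOp]
  · simp [matOp_apply, hi, h0]

end RKHSMult

namespace DruryArveson

variable {d : ℕ} {V W : Set (Ball d)}

/-! ### The coordinate row on `H_V` -/

theorem inner_kerV (x : V) (f : HV V) : inner ℂ (kerV x) f = f x :=
  inner_ker (x : Ball d) (f : Space d)

theorem inner_kerV_kerV (x y : V) :
    inner ℂ (kerV x) (kerV y) = 1 / (1 - inner ℂ ((y : Ball d) : EuclideanSpace ℂ (Fin d))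
      ((x : Ball d) : EuclideanSpace ℂ (Fin d))) := by
  rw [inner_kerV]
  exact ker_apply (x : Ball d) (y : Ball d)

theorem one_sub_inner_ne_zero (x y : Ball d) :
    1 - inner ℂ (x : EuclideanSpace ℂ (Fin d)) (y : EuclideanSpace ℂ (Fin d)) ≠ 0 := by
  intro h
  have := norm_inner_lt_one x y
  rw [← sub_eq_zero.1 h] at this
  simp at this

theorem denseRange_linearCombination_kerV :
    DenseRange (Finsupp.linearCombination ℂ (kerV : V → HV V)) := by
  have hspan : (LinearMap.range (Finsupp.linearCombination ℂ (kerV : V → HV V))).topologicalClosure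
      = ⊤ := by
    rw [Submodule.topologicalClosure_eq_top_iff, Submodule.eq_bot_iff]
    intro f hf
    refine RKHS.ext fun x => ?_
    rw [← inner_kerV]
    simpa using (Submodule.mem_orthogonal _ _).1 hf _
      ⟨Finsupp.single x 1, by simp⟩
  rw [DenseRange, ← LinearMap.coe_range, Submodule.dense_iff_topologicalClosure_eq_top, hspan]

theorem kerV_injective : Function.Injective (kerV : V → HV V) := by
  intro x y h
  -- The defining property of `k_x` determines `⟨z, x⟩` for every `z ∈ V`.
  have hz : ∀ z : V, inner ℂ ((x : Ball d) : EuclideanSpace ℂ (Fin d))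
      ((z : Ball d) : EuclideanSpace ℂ (Fin d)) =
      inner ℂ ((y : Ball d) : EuclideanSpace ℂ (Fin d))
      ((z : Ball d) : EuclideanSpace ℂ (Fin d)) := by
    intro z
    have h1 := inner_kerV_kerV z x
    rw [h, inner_kerV_kerV, one_div, one_div, inv_inj, sub_right_inj] at h1
    exact h1.symm
  have h0 : ((x : Ball d) : EuclideanSpace ℂ (Fin d)) = (y : Ball d) := by
    rw [← sub_eq_zero, ← inner_self_eq_zero (𝕜 := ℂ), inner_sub_right, inner_sub_left,
      inner_sub_left, hz x, hz y]
    ring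
  exact Subtype.ext (Subtype.ext h0)

/-- The vector `(conj xᵢ k_x)ᵢ`, to which the adjoint of the coordinate row maps `k_x`. -/
def coordKer (x : V) : PiLp 2 fun _ : Fin d => HV V :=
  WithLp.toLp 2 fun i => star (((x : Ball d) : EuclideanSpace ℂ (Fin d)) i) • kerV x

theorem inner_coordKer (x : V) (g : PiLp 2 fun _ : Fin d => HV V) :
    inner ℂ (coordKer x) g = ∑ i, ((x : Ball d) : EuclideanSpace ℂ (Fin d)) i * g i x := by
  rw [PiLp.inner_apply]
  refine Finset.sum_congr rfl fun i _ => ?_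
  rw [coordKer, PiLp.toLp_apply, inner_smul_left, inner_kerV]
  simp

/-- The Gram matrix of `coordKer` is that of the kernel functions minus the all-ones matrix:
`⟨x, y⟩ / (1 - ⟨x, y⟩) = 1 / (1 - ⟨x, y⟩) - 1`. -/
theorem inner_coordKer_coordKer (x y : V) :
    inner ℂ (coordKer x) (coordKer y) = inner ℂ (kerV x) (kerV y) - 1 := by
  have h : inner ℂ (coordKer x) (coordKer y) =
      inner ℂ ((y : Ball d) : EuclideanSpace ℂ (Fin d))
        ((x : Ball d) : EuclideanSpace ℂ (Fin d)) * inner ℂ (kerV x) (kerV y) := by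
    rw [inner_coordKer, PiLp.inner_apply, Finset.sum_mul]
    refine Finset.sum_congr rfl fun i _ => ?_
    rw [← inner_kerV, coordKer, PiLp.toLp_apply, inner_smul_right]
    simp [mul_assoc]
  rw [h, inner_kerV_kerV]
  have := one_sub_inner_ne_zero (y : Ball d) (x : Ball d)
  field_simp
  ring

theorem norm_sq_linearCombination_coordKer (c : V →₀ ℂ) :
    ‖Finsupp.linearCombination ℂ (coordKer : V → _) c‖ ^ 2 =
      ‖Finsupp.linearCombination ℂ (kerV : V → _) c‖ ^ 2 - ‖c.sum fun _ a => a‖ ^ 2 := by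
  suffices h : ((‖Finsupp.linearCombination ℂ (coordKer : V → _) c‖ : ℂ) ^ 2) =
      (‖Finsupp.linearCombination ℂ (kerV : V → _) c‖ : ℂ) ^ 2 - (‖c.sum fun _ a => a‖ : ℂ) ^ 2 by
    exact_mod_cast h
  have hn : ∀ {E : Type} [NormedAddCommGroup E] [InnerProductSpace ℂ E] (u : V → E),
      (‖Finsupp.linearCombination ℂ u c‖ : ℂ) ^ 2 =
        ∑ x ∈ c.support, ∑ y ∈ c.support, star (c x) * c y * inner ℂ (u x) (u y) := by
    intro E _ _ u
    have h1 := (inner_self_eq_norm_sq_to_K (𝕜 := ℂ) (Finsupp.linearCombination ℂ u c)).symm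
    rw [Finsupp.linearCombination_apply, Finsupp.sum_inner] at h1
    simp only [Finsupp.inner_sum] at h1
    rw [Finsupp.linearCombination_apply]
    refine h1.trans (Finset.sum_congr rfl fun x _ => ?_)
    refine Finset.sum_congr rfl fun y _ => ?_
    dsimp only
    rw [inner_smul_left, inner_smul_right, starRingEnd_apply]
    ring
  rw [hn, hn, ← Complex.conj_mul', Finsupp.sum, map_sum, Finset.sum_mul_sum,
    ← Finset.sum_sub_distrib]
  refine Finset.sum_congr rfl fun x _ => ?_
  rw [← Finset.sum_sub_distrib]
  refine Finset.sum_congr rfl fun y _ => ?_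
  rw [inner_coordKer_coordKer, starRingEnd_apply]
  ring

theorem norm_linearCombination_coordKer_le (c : V →₀ ℂ) :
    ‖Finsupp.linearCombination ℂ (coordKer : V → _) c‖ ≤
      1 * ‖Finsupp.linearCombination ℂ (kerV : V → _) c‖ := by
  rw [one_mul]
  refine le_of_sq_le_sq ?_ (norm_nonneg _)
  rw [norm_sq_linearCombination_coordKer]
  exact sub_le_self _ (sq_nonneg _)

variable (V) in
/-- The column operator `k_x ↦ (conj xᵢ k_x)ᵢ` on `H_V`. -/
def coordCol : HV V →L[ℂ] PiLp 2 fun _ : Fin d => HV V :=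
  (Finsupp.linearCombination ℂ (coordKer : V → _)).extendOfNorm
    (Finsupp.linearCombination ℂ (kerV : V → _))

theorem coordCol_linearCombination (c : V →₀ ℂ) :
    coordCol V (Finsupp.linearCombination ℂ (kerV : V → _) c) =
      Finsupp.linearCombination ℂ (coordKer : V → _) c :=
  LinearMap.extendOfNorm_eq denseRange_linearCombination_kerV
    ⟨1, norm_linearCombination_coordKer_le⟩ c

theorem coordCol_kerV (x : V) : coordCol V (kerV x) = coordKer x := by
  simpa using coordCol_linearCombination (Finsupp.single x (1 : ℂ))

theorem norm_coordCol_le : ‖coordCol V‖ ≤ 1 :=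
  LinearMap.opNorm_extendOfNorm_le denseRange_linearCombination_kerV zero_le_one
    norm_linearCombination_coordKer_le

/-- `coordCol` preserves the norm of `k_x - k_y`, so it has norm one once `V` has two points. -/
theorem one_le_norm_coordCol (hV : 2 ≤ V.encard) : 1 ≤ ‖coordCol V‖ := by
  obtain ⟨a, b, ha, hb, hab⟩ := Set.one_lt_encard_iff.1 (lt_of_lt_of_le (by norm_num) hV)
  set c : V →₀ ℂ := Finsupp.single ⟨a, ha⟩ 1 - Finsupp.single ⟨b, hb⟩ 1 with hc
  have hsum : (c.sum fun _ z => z) = 0 := by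
    rw [hc, Finsupp.sum_sub_index (fun _ _ _ => rfl)]
    simp
  have h0 : 0 < ‖Finsupp.linearCombination ℂ (kerV : V → _) c‖ := by
    rw [norm_pos_iff, hc, map_sub]
    simp only [Finsupp.linearCombination_single, one_smul]
    exact sub_ne_zero.2 fun h => hab (congrArg Subtype.val (kerV_injective h))
  have h1 : ‖Finsupp.linearCombination ℂ (coordKer : V → _) c‖ =
      ‖Finsupp.linearCombination ℂ (kerV : V → _) c‖ := by
    refine (sq_eq_sq₀ (norm_nonneg _) (norm_nonneg _)).1 ?_
    rw [norm_sq_linearCombination_coordKer, hsum]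
    simp
  have h2 := (coordCol V).le_opNorm (Finsupp.linearCombination ℂ (kerV : V → _) c)
  rw [coordCol_linearCombination, h1] at h2
  exact le_of_mul_le_mul_right (by simpa using h2) h0

theorem adjoint_coordCol_apply (g : PiLp 2 fun _ : Fin d => HV V) (x : V) :
    (coordCol V).adjoint g x = ∑ i, ((x : Ball d) : EuclideanSpace ℂ (Fin d)) i * g i x := by
  rw [← inner_kerV, ContinuousLinearMap.adjoint_inner_right, coordCol_kerV, inner_coordKer]

variable (V) in
theorem isVectorMult_coord :
    IsVectorMult (HV V) fun x : V => ((x : Ball d) : EuclideanSpace ℂ (Fin d)) := by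
  intro i g
  refine ⟨(coordCol V).adjoint (PiLp.single 2 i g), fun x => ?_⟩
  rw [adjoint_coordCol_apply, Finset.sum_eq_single i]
  · simp
  · intro j _ hj
    simp [hj]
  · simp

theorem norm_rowOp_coord : ‖rowOp (isVectorMult_coord V)‖ = ‖coordCol V‖ := by
  have h : rowOp (isVectorMult_coord V) = (coordCol V).adjoint := by
    ext g : 1
    exact RKHS.ext fun x => by rw [rowOp_apply, adjoint_coordCol_apply]
  rw [h, LinearIsometryEquiv.norm_map]

/-! ### Isomorphisms of the Hilbert spaces and composition -/

theorem IsRKHSIso.symm {F : V ≃ W} {lam : V → ℂ} {T : HV V ≃L[ℂ] HV W} (hT : IsRKHSIso T F lam) :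
    IsRKHSIso T.symm F.symm fun w => (lam (F.symm w))⁻¹ where
  ne_zero w := inv_ne_zero (hT.ne_zero _)
  map_kerV w := by
    rw [ContinuousLinearEquiv.symm_apply_eq, map_smul, hT.map_kerV, smul_smul,
      inv_mul_cancel₀ (hT.ne_zero _), one_smul, Equiv.apply_symm_apply]

/-- `M_{f ∘ F⁻¹} = (T⁻¹)* M_f T*`, as is seen on function values. -/
theorem IsRKHSIso.adjoint_mulOp_adjoint_apply {F : V ≃ W} {lam : V → ℂ} {T : HV V ≃L[ℂ] HV W}
    (hT : IsRKHSIso T F lam) (f : MV V) (g : HV W) (w : W) :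
    (T.symm : HV W →L[ℂ] HV V).adjoint (mulOp f ((T : HV V →L[ℂ] HV W).adjoint g)) w =
      (f : V → ℂ) (F.symm w) * g w := by
  have h1 := hT.ne_zero (F.symm w)
  have h2 : star (lam (F.symm w)) ≠ 0 := star_ne_zero.2 h1
  rw [← inner_kerV, ContinuousLinearMap.adjoint_inner_right, ContinuousLinearEquiv.coe_coe,
    hT.symm.map_kerV, inner_smul_left, inner_kerV, mulOp_apply, ← inner_kerV (F.symm w),
    ContinuousLinearMap.adjoint_inner_right, ContinuousLinearEquiv.coe_coe, hT.map_kerV,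
    inner_smul_left, Equiv.apply_symm_apply, inner_kerV, starRingEnd_apply, star_inv₀,
    starRingEnd_apply]
  field_simp

theorem IsRKHSIso.comp_symm_mem {F : V ≃ W} {lam : V → ℂ} {T : HV V ≃L[ℂ] HV W}
    (hT : IsRKHSIso T F lam) (f : MV V) : (fun w => (f : V → ℂ) (F.symm w)) ∈ MV W :=
  fun g => ⟨_, hT.adjoint_mulOp_adjoint_apply f g⟩

/-- The composition isomorphism `f ↦ f ∘ F⁻¹` of multiplier algebras. -/
def IsRKHSIso.multEquiv {F : V ≃ W} {lam : V → ℂ} {T : HV V ≃L[ℂ] HV W}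
    (hT : IsRKHSIso T F lam) : MV V ≃ₐ[ℂ] MV W where
  toFun f := ⟨fun w => (f : V → ℂ) (F.symm w), hT.comp_symm_mem f⟩
  invFun f := ⟨fun v => (f : W → ℂ) (F v), hT.symm.comp_symm_mem f⟩
  left_inv f := by ext; simp
  right_inv f := by ext; simp
  map_mul' _ _ := rfl
  map_add' _ _ := rfl
  commutes' _ := rfl

theorem IsRKHSIso.cbNorm_multEquiv_le {F : V ≃ W} {lam : V → ℂ} {T : HV V ≃L[ℂ] HV W}
    (hT : IsRKHSIso T F lam) :
    cbNorm hT.multEquiv.toAlgHom ≤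
      ENNReal.ofReal (‖(T : HV V →L[ℂ] HV W)‖ * ‖(T.symm : HV W →L[ℂ] HV V)‖) := by
  refine (cbNorm_le_of_mulOp_eq _ (T.symm : HV W →L[ℂ] HV V).adjoint
    (T : HV V →L[ℂ] HV W).adjoint fun f g => ?_).trans ?_
  · refine RKHS.ext fun w => ?_
    rw [hT.adjoint_mulOp_adjoint_apply, mulOp_apply]
    rfl
  · rw [LinearIsometryEquiv.norm_map, LinearIsometryEquiv.norm_map, mul_comm]

end DruryArveson

end

open RKHSMult DruryArveson in
theorem corollary4p0p5 {d : ℕ} {V W : Set (Ball d)} (hV : IsVariety V) (hW : IsVariety W)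
    (F : V ≃ W) (lam : V → ℂ) (T : HV V ≃L[ℂ] HV W) (hT : IsRKHSIso T F lam) :
    ∃ φ : MV V ≃ₐ[ℂ] MV W,
      IsMultiplierAlgebraIso φ ∧
      (∀ (f : MV V) (w : W), (φ f : W → ℂ) w = (f : V → ℂ) (F.symm w)) ∧
      (2 ≤ V.encard →
        ∃ hG : IsVectorMult (HV W) (fun w : W => ((F.symm w : Ball d) : EuclideanSpace ℂ (Fin d))),
          1 / cbNorm φ.symm.toAlgHom ≤ ENNReal.ofReal (vectorMultNorm hG) ∧
          ENNReal.ofReal (vectorMultNorm hG) ≤ cbNorm φ.toAlgHom ∧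
          cbNorm φ.toAlgHom ≤
            ENNReal.ofReal (‖(T : HV V →L[ℂ] HV W)‖ * ‖(T.symm : HV W →L[ℂ] HV V)‖)) := by
  have hcb : cbNorm hT.multEquiv.symm.toAlgHom < ∞ :=
    hT.symm.cbNorm_multEquiv_le.trans_lt ENNReal.ofReal_lt_top
  refine ⟨hT.multEquiv, ⟨hT.cbNorm_multEquiv_le.trans_lt ENNReal.ofReal_lt_top, hcb,
    F.symm, fun _ _ => rfl⟩, fun _ _ => rfl, fun h2 => ?_⟩
  have hG : IsVectorMult (HV W)
      (fun w : W => ((F.symm w : Ball d) : EuclideanSpace ℂ (Fin d))) :=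
    fun i => hT.comp_symm_mem ⟨_, isVectorMult_coord V i⟩
  -- For `d = 0` the ball is a single point, so there is a row to put the coordinates in.
  obtain ⟨i₀⟩ : Nonempty (Fin d) := by
    rw [← not_isEmpty_iff]
    intro _
    exact absurd (h2.trans (Set.encard_le_one_iff.2 fun a b _ _ =>
      Subtype.ext (Subsingleton.elim _ _))) (by norm_num)
  set A : Matrix (Fin d) (Fin d) (MV V) :=
    Matrix.updateRow 0 i₀ fun i => ⟨_, isVectorMult_coord V i⟩ with hA
  set B : Matrix (Fin d) (Fin d) (MV W) := Matrix.updateRow 0 i₀ fun i => ⟨_, hG i⟩ with hB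
  have hAn : ‖matOp A‖ = ‖coordCol V‖ :=
    (norm_matOp_updateRow (isVectorMult_coord V) i₀).trans norm_rowOp_coord
  have hBn : ‖matOp B‖ = vectorMultNorm hG := norm_matOp_updateRow hG i₀
  have hAB : A.map hT.multEquiv.toAlgHom = B := by
    rw [hA, Matrix.map_updateRow, Matrix.map_zero _ (map_zero _)]
    rfl
  have hBA : B.map hT.multEquiv.symm.toAlgHom = A := by
    rw [← hAB]
    ext i j : 2
    exact congrArg Subtype.val (hT.multEquiv.symm_apply_apply (A i j))
  refine ⟨hG, ?_, ?_, hT.cbNorm_multEquiv_le⟩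
  · have h := norm_matOp_map_le hcb.ne B
    rw [hBA, hAn, hBn] at h
    refine ENNReal.div_le_of_le_mul' ?_
    rw [← ENNReal.ofReal_toReal hcb.ne, ← ENNReal.ofReal_mul ENNReal.toReal_nonneg,
      ENNReal.one_le_ofReal]
    exact (one_le_norm_coordCol h2).trans h
  · rw [← hBn, ← hAB]
    exact ofReal_norm_matOp_map_le_cbNorm _ (hAn.trans_le norm_coordCol_le)
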